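/- Let $d\ge 3$ and let $\Lambda$ be a full rank lattice in $\mathbb R^d$ with determinant $1$. Let $\Lambda^\ast=\{z\in\mathbb R^d : \langle z,z'\rangle\in\mathbb Z \text{ for all } z'\in\Lambda\}$ be its dual lattice, and let $$\Lambda^{\circledast}=\{z_1\wedge z_2 : z_1,z_2\in\Lambda^\ast\}\subset\textstyle\bigwedge^2\mathbb R^d .$$ Let $\eta_1,\dots,\eta_d$ be positive real numbers, let $$\mathcal P=\{z\in\mathbb R^d : |z_i|\le\eta_i,\ i=1,\dots,d\},$$ and let its $(d-2)$-th pseudocompound be $$\mathcal P^{\circledast}=\Big\{Z=\sum_{1\le i<j\le d}Z_{ij}\,e_i\wedge e_j\in\textstyle\bigwedge^2\mathbb R^d : |Z_{ij}|\le\dfrac1{\eta_i\eta_j}\prod_{k=1}^d\eta_k,\ 1\le i<j\le d\Big\},$$ where $e_1,\dots,e_d$ is the standard basis of $\mathbb R^d$. If $\mathcal P^{\circledast}\cap\Lambda^{\circledast}\ne\{0\}$, then $c\,\mathcal P\cap\Lambda\neq\{0\}$, where $$c=\Big(\frac{d(d-1)}2\Big)^{\frac1{2(d-2)}} .$$ 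-/

import Mathlib

open scoped Pointwise

noncomputable section

/-- The dual lattice `{z | ⟪z, z'⟫ ∈ ℤ for all z' ∈ Λ}` of a lattice `Λ` in `ℝ^d`. -/
def dualLattice {d : ℕ} (Λ : Submodule ℤ (EuclideanSpace ℝ (Fin d))) :
    Submodule ℤ (EuclideanSpace ℝ (Fin d)) :=
  LinearMap.BilinForm.dualSubmodule (innerₗ (EuclideanSpace ℝ (Fin d))) Λ

theorem mem_dualLattice {d : ℕ} (Λ : Submodule ℤ (EuclideanSpace ℝ (Fin d)))
    (z : EuclideanSpace ℝ (Fin d)) :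
    z ∈ dualLattice Λ ↔ ∀ z' ∈ Λ, ∃ n : ℤ, (n : ℝ) = inner ℝ z z' := by
  simp [dualLattice, LinearMap.BilinForm.mem_dualSubmodule, Submodule.mem_one]

/-- The parallelepiped `{z | |z_i| ≤ η_i for all i}` in `ℝ^d`. -/
def coordBox {d : ℕ} (η : Fin d → ℝ) : Set (EuclideanSpace ℝ (Fin d)) :=
  {z | ∀ i, |z i| ≤ η i}

/-- The coordinate `Z_{ij}`, `i < j`, of a bivector `Z = ∑_{i<j} Z_{ij} e_i ∧ e_j`, where
`e_1, …, e_d` is the standard basis of `ℝ^d`. -/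
def bivectorCoord {d : ℕ} (Z : ⋀[ℝ]^2 (EuclideanSpace ℝ (Fin d))) (i j : Fin d) (hij : i < j) :
    ℝ :=
  ((EuclideanSpace.basisFun (Fin d) ℝ).toBasis.exteriorPower 2).repr Z
    ⟨{i, j}, Finset.card_pair hij.ne⟩

/-- The `(d-2)`-th pseudocompound of the parallelepiped `coordBox η`. -/
def secondPseudocompound {d : ℕ} (η : Fin d → ℝ) : Set (⋀[ℝ]^2 (EuclideanSpace ℝ (Fin d))) :=
  {Z | ∀ (i j : Fin d) (hij : i < j), |bivectorCoord Z i j hij| ≤ 1 / (η i * η j) * ∏ k, η k}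

/-- The set of all `z₁ ∧ z₂` with `z₁`, `z₂` in the dual lattice of `Λ`. -/
def dualDecomposables {d : ℕ} (Λ : Submodule ℤ (EuclideanSpace ℝ (Fin d))) :
    Set (⋀[ℝ]^2 (EuclideanSpace ℝ (Fin d))) :=
  {Z | ∃ z₁ ∈ dualLattice Λ, ∃ z₂ ∈ dualLattice Λ, Z = exteriorPower.ιMulti ℝ 2 ![z₁, z₂]}

end

open MeasureTheory
open scoped ENNReal

/-! Let z₁ ∧ z₂ be a nonzero point of the pseudocompound, with z₁, z₂ in the dual lattice. Put u =
(η_i z₁_i), v = (η_i z₂_i) and x = (z_i / η_i), so that the box becomes a cube, ⟨z₁, z⟩ = ⟨u, x⟩,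
and every coordinate of u ∧ v is at most P = ∏ η_k in absolute value. By the Lagrange identity the
Gram determinant G of u, v is at most d(d-1)/2 · P².

For r > c consider the z with |⟨u, x⟩| < 1 and |⟨v, x⟩| < 1 such that the projection of x to the
orthogonal complement of u, v lies in the cube of half-side r. By Vaaler's theorem the central
section of that cube has volume at least (2r)^(d-2), so this convex symmetric set has volume at
least 4 (2r)^(d-2) P / √G > 2^d. Minkowski's theorem gives a nonzero lattice point z in it. Both
⟨z₁, z⟩ and ⟨z₂, z⟩ are integers of absolute value below 1, hence 0; so x is its own projection and
|z_i| ≤ r η_i. Discreteness of the lattice lets r decrease to c.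

Vaaler's theorem comes from peakedness: on the line, the uniform law on [-1/2, 1/2] gives every
symmetric convex set at least its mass under the density exp(-πx²). The Prékopa–Leindler inequality
carries this comparison to products. Applied to thin slabs around a subspace, it bounds the section
of the cube below by the Gaussian integral over the subspace, which is 1. -/

/-! ### Brunn–Minkowski on the line and the Prékopa–Leindler inequality -/

theorem measure_add_le_of_isCompact {K L C : Set ℝ} (hK : IsCompact K) (hL : IsCompact L)
    (hK0 : K.Nonempty) (hL0 : L.Nonempty) {a b : ℝ} (ha : 0 < a) (hb : 0 < b)
    (h : ∀ x ∈ K, ∀ y ∈ L, a * x + b * y ∈ C) :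
    ENNReal.ofReal a * volume K + ENNReal.ofReal b * volume L ≤ volume C := by
  -- The translates aK + b min L and a max K + bL both lie in C, on opposite sides of p, and share
  -- only the null set {p}.
  set p := a * sSup K + b * sInf L with hp
  have hS₁ : (fun x => x + b * sInf L) '' (a • K) ⊆ C ∩ Set.Iic p := by
    rintro _ ⟨_, ⟨x, hx, rfl⟩, rfl⟩
    refine ⟨h x hx _ (hL.sInf_mem hL0), ?_⟩
    have := mul_le_mul_of_nonneg_left (le_csSup hK.bddAbove hx) ha.le
    simp only [Set.mem_Iic, smul_eq_mul, hp]
    linarith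
  have hS₂ : ((fun y => y + a * sSup K) '' (b • L)) \ {p} ⊆ C \ Set.Iic p := by
    rintro _ ⟨⟨_, ⟨y, hy, rfl⟩, rfl⟩, hne⟩
    have hmem := h _ (hK.sSup_mem hK0) y hy
    have := mul_le_mul_of_nonneg_left (csInf_le hL.bddBelow hy) hb.le
    simp only [smul_eq_mul, Set.mem_singleton_iff, Set.mem_sdiff, Set.mem_Iic, not_le, hp] at *
    refine ⟨by rwa [add_comm], lt_of_le_of_ne (by linarith) (Ne.symm hne)⟩
  have e₁ : volume ((fun x => x + b * sInf L) '' (a • K)) = ENNReal.ofReal a * volume K := by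
    rw [Set.image_add_right, measure_preimage_add_right, Measure.addHaar_smul_of_nonneg _ ha.le]
    simp
  have e₂ : volume (((fun y => y + a * sSup K) '' (b • L)) \ {p})
      = ENNReal.ofReal b * volume L := by
    rw [measure_sdiff_null (measure_singleton p), Set.image_add_right, measure_preimage_add_right,
      Measure.addHaar_smul_of_nonneg _ hb.le]
    simp
  rw [← e₁, ← e₂, ← measure_inter_add_sdiff C (measurableSet_Iic (a := p))]
  exact add_le_add (measure_mono hS₁) (measure_mono hS₂)

/-- The one-dimensional Brunn–Minkowski inequality. -/
theorem measure_add_le_of_forall_add_mem {A B C : Set ℝ} (hA : MeasurableSet A)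
    (hB : MeasurableSet B) (hA0 : A.Nonempty) (hB0 : B.Nonempty) {a b : ℝ} (ha : 0 < a)
    (hb : 0 < b) (h : ∀ x ∈ A, ∀ y ∈ B, a * x + b * y ∈ C) :
    ENNReal.ofReal a * volume A + ENNReal.ofReal b * volume B ≤ volume C := by
  obtain ⟨x₀, hx₀⟩ := hA0
  obtain ⟨y₀, hy₀⟩ := hB0
  have key : ∀ K, (K ⊆ A ∧ IsCompact K) → ∀ L, (L ⊆ B ∧ IsCompact L) →
      ENNReal.ofReal a * volume K + ENNReal.ofReal b * volume L ≤ volume C := by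
    rintro K ⟨hKA, hK⟩ L ⟨hLB, hL⟩
    -- The compact sets from inner regularity may be empty, so a point of A and a point of B are
    -- adjoined.
    have := measure_add_le_of_isCompact (hK.insert x₀) (hL.insert y₀) (Set.insert_nonempty _ _)
      (Set.insert_nonempty _ _) ha hb (fun x hx y hy =>
        h x (Set.insert_subset hx₀ hKA hx) y (Set.insert_subset hy₀ hLB hy))
    refine le_trans ?_ this
    gcongr <;> exact Set.subset_insert _ _
  rw [hA.measure_eq_iSup_isCompact, hB.measure_eq_iSup_isCompact]
  simp only [ENNReal.mul_iSup, iSup_and']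
  exact ENNReal.biSup_add_biSup_le' ⟨∅, Set.empty_subset _, isCompact_empty⟩
    ⟨∅, Set.empty_subset _, isCompact_empty⟩ key

theorem ENNReal.rpow_mul_rpow_le_add {a b : ℝ} (ha : 0 < a) (hb : 0 < b) (hab : a + b = 1)
    (x y : ℝ≥0∞) : x ^ a * y ^ b ≤ ENNReal.ofReal a * x + ENNReal.ofReal b * y := by
  rcases eq_or_ne x ∞ with rfl | hx
  · rw [ENNReal.mul_top (by simpa using ha)]
    simp
  rcases eq_or_ne y ∞ with rfl | hy
  · rw [ENNReal.mul_top (by simpa using hb)]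
    simp
  lift x to NNReal using hx
  lift y to NNReal using hy
  lift a to NNReal using ha.le
  lift b to NNReal using hb.le
  have := NNReal.geom_mean_le_arith_mean2_weighted a b x y (by exact_mod_cast hab)
  rw [← ENNReal.coe_rpow_of_nonneg _ a.coe_nonneg, ← ENNReal.coe_rpow_of_nonneg _ b.coe_nonneg]
  simp only [ENNReal.ofReal_coe_nnreal]
  exact_mod_cast this

theorem lintegral_eq_lintegral_measure_ofReal_lt {E : Type*} [MeasurableSpace E] (μ : Measure E)
    {f : E → ℝ≥0∞} (hf : Measurable f) (hfin : ∀ x, f x ≠ ∞) :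
    ∫⁻ x, f x ∂μ = ∫⁻ t in Set.Ioi (0 : ℝ), μ {x | ENNReal.ofReal t < f x} := by
  have := lintegral_eq_lintegral_meas_lt μ (f := fun x => (f x).toReal)
    (Filter.Eventually.of_forall fun x => ENNReal.toReal_nonneg) hf.ennreal_toReal.aemeasurable
  simp only [ENNReal.ofReal_toReal (hfin _)] at this
  rw [this]
  refine setLIntegral_congr_fun measurableSet_Ioi fun t ht => ?_
  congr 1
  ext x
  exact (ENNReal.ofReal_lt_iff_lt_toReal (le_of_lt ht) (hfin x)).symm

/-- With both suprema equal to 1, the superlevel sets of f and g are nonempty at every level t < 1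
and empty from 1 on. Brunn–Minkowski therefore applies at each level, and integrating over t gives
the claim. -/
theorem lintegral_add_le_of_iSup_eq_one {a b : ℝ} (ha : 0 < a) (hb : 0 < b) {f g h : ℝ → ℝ≥0∞}
    (hf : Measurable f) (hg : Measurable g) (hh : Measurable h) (hfs : ⨆ x, f x = 1)
    (hgs : ⨆ x, g x = 1) (hfin : ∀ x, h x ≠ ∞)
    (hfgh : ∀ (t : ℝ≥0∞) (x y : ℝ), t < f x → t < g y → t < h (a * x + b * y)) :
    ENNReal.ofReal a * (∫⁻ x, f x) + ENNReal.ofReal b * (∫⁻ x, g x) ≤ ∫⁻ x, h x := by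
  have layer : ∀ {u : ℝ → ℝ≥0∞}, Measurable u → ⨆ x, u x = 1 →
      ∫⁻ x, u x = ∫⁻ t in Set.Ioo (0 : ℝ) 1, volume {x | ENNReal.ofReal t < u x} := by
    intro u hu hus
    have hu1 : ∀ x, u x ≤ 1 := fun x => hus ▸ le_iSup u x
    rw [lintegral_eq_lintegral_measure_ofReal_lt _ hu
      fun x => ((hu1 x).trans_lt ENNReal.one_lt_top).ne,
      ← Set.Ioo_union_Ici_eq_Ioi (zero_lt_one (α := ℝ)),
      lintegral_union measurableSet_Ici (Set.disjoint_left.2 fun x hx hx' => hx.2.not_ge hx')]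
    rw [setLIntegral_congr_fun measurableSet_Ici (g := fun _ => 0), lintegral_zero, add_zero]
    intro t ht
    have : {x | ENNReal.ofReal t < u x} = ∅ := by
      refine Set.eq_empty_of_forall_notMem fun x hx => ?_
      exact (hx.trans_le (hu1 x)).not_ge (by simpa using ht)
    simp [this]
  have hmeas : ∀ {u : ℝ → ℝ≥0∞}, Measurable fun t : ℝ => volume {x | ENNReal.ofReal t < u x} := by
    intro u
    refine Antitone.measurable fun s t hst => measure_mono fun x hx => ?_
    exact lt_of_le_of_lt (ENNReal.ofReal_le_ofReal hst) hx
  rw [layer hf hfs, layer hg hgs, lintegral_eq_lintegral_measure_ofReal_lt _ hh hfin,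
    ← lintegral_const_mul _ hmeas, ← lintegral_const_mul _ hmeas,
    ← lintegral_add_left (hmeas.const_mul _)]
  refine le_trans ?_ (lintegral_mono_set (show Set.Ioo (0 : ℝ) 1 ⊆ Set.Ioi 0 from fun t ht => ht.1))
  refine setLIntegral_mono hmeas fun t ht => ?_
  have ht1 : ENNReal.ofReal t < 1 := by simpa using ht.2
  have nonempty : ∀ {u : ℝ → ℝ≥0∞}, ⨆ x, u x = 1 → {x | ENNReal.ofReal t < u x}.Nonempty :=
    fun {u} hu => by
      obtain ⟨x, hx⟩ := lt_iSup_iff.1 (hu.symm ▸ ht1 : ENNReal.ofReal t < ⨆ x, u x)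
      exact ⟨x, hx⟩
  exact measure_add_le_of_forall_add_mem (hf measurableSet_Ioi) (hg measurableSet_Ioi)
    (nonempty hfs) (nonempty hgs) ha hb
    fun x hx y hy => hfgh _ x y hx hy

/-- The Prékopa–Leindler inequality for functions bounded by one, as a property of a measure. -/
def PrekopaLeindler {E : Type*} [AddCommGroup E] [Module ℝ E] [MeasurableSpace E]
    (μ : Measure E) : Prop :=
  ∀ a b : ℝ, 0 < a → 0 < b → a + b = 1 → ∀ f g h : E → ℝ≥0∞, Measurable f → Measurable g →
    Measurable h → (∀ x, f x ≤ 1) → (∀ x, g x ≤ 1) →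
    (∀ x y, f x ^ a * g y ^ b ≤ h (a • x + b • y)) →
    (∫⁻ x, f x ∂μ) ^ a * (∫⁻ x, g x ∂μ) ^ b ≤ ∫⁻ x, h x ∂μ

theorem prekopaLeindler_volume_real : PrekopaLeindler (volume : Measure ℝ) := by
  intro a b ha hb hab f g h hf hg hh hf1 hg1 hfgh
  wlog hfin : ∀ x, h x ≤ 1 generalizing h
  · refine (this (fun x => min (h x) 1) (hh.min measurable_const) (fun x y => le_min (hfgh x y) ?_)
      fun x => min_le_right _ _).trans (lintegral_mono fun x => min_le_left _ _)
    calc f x ^ a * g y ^ b ≤ 1 ^ a * 1 ^ b := by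
          gcongr
          exacts [hf1 x, hg1 y]
      _ = 1 := by simp
  set A := ⨆ x, f x with hA
  set B := ⨆ x, g x with hB
  rcases eq_or_ne A 0 with hA0 | hA0
  · have : ∀ x, f x = 0 := by simpa [A] using hA0
    simp [this, ha]
  rcases eq_or_ne B 0 with hB0 | hB0
  · have : ∀ x, g x = 0 := by simpa [B] using hB0
    simp [this, hb]
  have hA1 : A ≠ ∞ := ((iSup_le hf1).trans_lt ENNReal.one_lt_top).ne
  have hB1 : B ≠ ∞ := ((iSup_le hg1).trans_lt ENNReal.one_lt_top).ne
  set D := A ^ a * B ^ b with hD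
  have hD0 : D ≠ 0 := mul_ne_zero (by simp [hA0, hA1]) (by simp [hB0, hB1])
  have hD1 : D ≠ ∞ := ENNReal.mul_ne_top (ENNReal.rpow_ne_top_of_nonneg ha.le hA1)
    (ENNReal.rpow_ne_top_of_nonneg hb.le hB1)
  -- Normalising by the suprema is compatible with the hypothesis because Dt = (At)^a (Bt)^b. The
  -- weighted AM–GM inequality then turns the additive bound into the multiplicative one.
  have key := lintegral_add_le_of_iSup_eq_one ha hb (f := fun x => A⁻¹ * f x)
    (g := fun x => B⁻¹ * g x) (h := fun x => D⁻¹ * h x) (hf.const_mul _) (hg.const_mul _)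
    (hh.const_mul _) (by rw [← ENNReal.mul_iSup, ENNReal.inv_mul_cancel hA0 hA1])
    (by rw [← ENNReal.mul_iSup, ENNReal.inv_mul_cancel hB0 hB1])
    (fun x => ENNReal.mul_ne_top (ENNReal.inv_ne_top.2 hD0)
      ((hfin x).trans_lt ENNReal.one_lt_top).ne) ?_
  · rw [lintegral_const_mul _ hf, lintegral_const_mul _ hg, lintegral_const_mul _ hh] at key
    have h2 := (ENNReal.rpow_mul_rpow_le_add ha hb hab _ _).trans key
    rw [ENNReal.mul_rpow_of_nonneg _ _ ha.le, ENNReal.mul_rpow_of_nonneg _ _ hb.le] at h2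
    calc (∫⁻ x, f x) ^ a * (∫⁻ x, g x) ^ b
        = D * ((A⁻¹ ^ a * (∫⁻ x, f x) ^ a) * (B⁻¹ ^ b * (∫⁻ x, g x) ^ b)) := by
          rw [ENNReal.inv_rpow, ENNReal.inv_rpow, mul_mul_mul_comm (A ^ a)⁻¹,
            ← ENNReal.mul_inv (Or.inr (ENNReal.rpow_ne_top_of_nonneg hb.le hB1))
              (Or.inl (ENNReal.rpow_ne_top_of_nonneg ha.le hA1)), ← mul_assoc,
            ENNReal.mul_inv_cancel hD0 hD1, one_mul]
      _ ≤ D * (D⁻¹ * ∫⁻ x, h x) := by gcongr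
      _ = ∫⁻ x, h x := by rw [← mul_assoc, ENNReal.mul_inv_cancel hD0 hD1, one_mul]
  · intro t x y htx hty
    have htop : t ≠ ∞ := (htx.trans_le le_top).ne
    have e : ∀ {C z : ℝ≥0∞}, C ≠ 0 → C ≠ ∞ → (t < C⁻¹ * z ↔ C * t < z) := by
      intro C z h0 h1
      rw [mul_comm C⁻¹, ← div_eq_mul_inv, ENNReal.lt_div_iff_mul_lt (Or.inl h0) (Or.inl h1),
        mul_comm]
    rw [e hA0 hA1] at htx
    rw [e hB0 hB1] at hty
    rw [e hD0 hD1]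
    refine lt_of_lt_of_le ?_ (hfgh x y)
    have : D * t = (A * t) ^ a * (B * t) ^ b := by
      rw [ENNReal.mul_rpow_of_nonneg _ _ ha.le, ENNReal.mul_rpow_of_nonneg _ _ hb.le,
        mul_mul_mul_comm, ← ENNReal.rpow_add_of_nonneg _ _ ha.le hb.le, hab, ENNReal.rpow_one]
    rw [this]
    exact ENNReal.mul_lt_mul (ENNReal.rpow_lt_rpow htx ha) (ENNReal.rpow_lt_rpow hty hb)

/-- A log-concave density can be absorbed into the three functions. -/
theorem PrekopaLeindler.withDensity {E : Type*} [AddCommGroup E] [Module ℝ E] [MeasurableSpace E]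
    {μ : Measure E} (hμ : PrekopaLeindler μ) {ρ : E → ℝ≥0∞} (hρ : Measurable ρ)
    (hρ1 : ∀ x, ρ x ≤ 1)
    (hlog : ∀ a b : ℝ, 0 < a → 0 < b → a + b = 1 → ∀ x y,
      ρ x ^ a * ρ y ^ b ≤ ρ (a • x + b • y)) :
    PrekopaLeindler (μ.withDensity ρ) := by
  intro a b ha hb hab f g h hf hg hh hf1 hg1 hfgh
  rw [lintegral_withDensity_eq_lintegral_mul _ hρ hf, lintegral_withDensity_eq_lintegral_mul _ hρ hg,
    lintegral_withDensity_eq_lintegral_mul _ hρ hh]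
  refine hμ a b ha hb hab _ _ _ (hρ.mul hf) (hρ.mul hg) (hρ.mul hh)
    (fun x => mul_le_one' (hρ1 x) (hf1 x)) (fun x => mul_le_one' (hρ1 x) (hg1 x)) fun x y => ?_
  simp only [Pi.mul_apply]
  rw [ENNReal.mul_rpow_of_nonneg _ _ ha.le, ENNReal.mul_rpow_of_nonneg _ _ hb.le, mul_mul_mul_comm]
  exact mul_le_mul' (hlog a b ha hb hab x y) (hfgh x y)

/-- The inequality for ν on the fibres says that the partial integrals satisfy the hypothesis for μ.
Total mass 1 of ν keeps them bounded by one. -/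
theorem PrekopaLeindler.prod {E F : Type*} [AddCommGroup E] [Module ℝ E] [MeasurableSpace E]
    [AddCommGroup F] [Module ℝ F] [MeasurableSpace F] {μ : Measure E} {ν : Measure F}
    [IsProbabilityMeasure ν] (hμ : PrekopaLeindler μ) (hν : PrekopaLeindler ν) :
    PrekopaLeindler (μ.prod ν) := by
  intro a b ha hb hab f g h hf hg hh hf1 hg1 hfgh
  rw [lintegral_prod _ hf.aemeasurable, lintegral_prod _ hg.aemeasurable,
    lintegral_prod _ hh.aemeasurable]
  have le_one : ∀ {u : F → ℝ≥0∞}, (∀ y, u y ≤ 1) → ∫⁻ y, u y ∂ν ≤ 1 := fun hu => by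
    simpa using lintegral_mono (μ := ν) hu
  refine hμ a b ha hb hab _ _ _ hf.lintegral_prod_right' hg.lintegral_prod_right'
    hh.lintegral_prod_right' (fun x => le_one fun y => hf1 _) (fun x => le_one fun y => hg1 _)
    fun x₁ x₂ => ?_
  exact hν a b ha hb hab _ _ _ (hf.comp measurable_prodMk_left) (hg.comp measurable_prodMk_left)
    (hh.comp measurable_prodMk_left) (fun y => hf1 _) (fun y => hg1 _)
    fun y₁ y₂ => hfgh (x₁, y₁) (x₂, y₂)

theorem PrekopaLeindler.map {E F : Type*} [AddCommGroup E] [Module ℝ E] [MeasurableSpace E]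
    [AddCommGroup F] [Module ℝ F] [MeasurableSpace F] {μ : Measure E} (hμ : PrekopaLeindler μ)
    (T : E →ₗ[ℝ] F) (hT : Measurable T) : PrekopaLeindler (μ.map T) := by
  intro a b ha hb hab f g h hf hg hh hf1 hg1 hfgh
  rw [lintegral_map hf hT, lintegral_map hg hT, lintegral_map hh hT]
  refine hμ a b ha hb hab _ _ _ (hf.comp hT) (hg.comp hT) (hh.comp hT) (fun x => hf1 _)
    (fun x => hg1 _) fun x y => ?_
  simpa using hfgh (T x) (T y)

/-! ### Peakedness and its stability under products -/

/-- `μ` gives at least the mass of `μ'` to every symmetric convex set. -/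
def MorePeaked {E : Type*} [AddCommGroup E] [Module ℝ E] [MeasurableSpace E]
    (μ μ' : Measure E) : Prop :=
  ∀ K : Set E, Convex ℝ K → (∀ x ∈ K, -x ∈ K) → MeasurableSet K → μ' K ≤ μ K

section

variable {E F : Type*} [AddCommGroup E] [Module ℝ E] [MeasurableSpace E]
  [AddCommGroup F] [Module ℝ F] [MeasurableSpace F]

theorem MorePeaked.trans {μ₁ μ₂ μ₃ : Measure E} (h₁ : MorePeaked μ₁ μ₂) (h₂ : MorePeaked μ₂ μ₃) :
    MorePeaked μ₁ μ₃ := fun K hK hs hm => (h₂ K hK hs hm).trans (h₁ K hK hs hm)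

theorem MorePeaked.map {μ μ' : Measure E} (h : MorePeaked μ μ') (T : E →ₗ[ℝ] F)
    (hT : Measurable T) : MorePeaked (μ.map T) (μ'.map T) := by
  intro K hK hs hm
  rw [Measure.map_apply hT hm, Measure.map_apply hT hm]
  exact h _ (hK.linear_preimage T) (fun x hx => by simpa using hs _ hx) (hT hm)

theorem PrekopaLeindler.rpow_measure_mul_le {ν : Measure F} (hν : PrekopaLeindler ν) {a b : ℝ}
    (ha : 0 < a) (hb : 0 < b) (hab : a + b = 1) {A B C : Set F} (hA : MeasurableSet A)
    (hB : MeasurableSet B) (hC : MeasurableSet C) (h : ∀ x ∈ A, ∀ y ∈ B, a • x + b • y ∈ C) :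
    ν A ^ a * ν B ^ b ≤ ν C := by
  have := hν a b ha hb hab (A.indicator 1) (B.indicator 1) (C.indicator 1)
    (measurable_one.indicator hA) (measurable_one.indicator hB) (measurable_one.indicator hC)
    (fun x => Set.indicator_le_self' (fun _ _ => zero_le) x)
    (fun x => Set.indicator_le_self' (fun _ _ => zero_le) x) ?_
  · simpa [lintegral_indicator_one, hA, hB, hC] using this
  · intro x y
    by_cases hx : x ∈ A
    · by_cases hy : y ∈ B
      · simp [hx, hy, h x hx y hy]
      · simp [hy, hb]
    · simp [hx, ha]

/-- The section mass x ↦ ν(K_x) is log-concave by Prékopa–Leindler and even because ν is. Its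
superlevel sets are thus convex and symmetric, and `h` compares them level by level in the
layer-cake formula. -/
theorem MorePeaked.prod_right {μ μ' : Measure E} (h : MorePeaked μ μ') {ν : Measure F}
    [SFinite μ] [SFinite μ'] [MeasurableNeg F]
    [IsProbabilityMeasure ν] [ν.IsNegInvariant] (hν : PrekopaLeindler ν) :
    MorePeaked (μ.prod ν) (μ'.prod ν) := by
  intro K hK hs hm
  rw [Measure.prod_apply hm, Measure.prod_apply hm]
  have hf := measurable_measure_prodMk_left (ν := ν) hm
  rw [lintegral_eq_lintegral_measure_ofReal_lt _ hf fun x => measure_ne_top _ _,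
    lintegral_eq_lintegral_measure_ofReal_lt _ hf fun x => measure_ne_top _ _]
  refine lintegral_mono fun t => h _ ?_ ?_ (hf measurableSet_Ioi)
  · intro x hx y hy a b ha hb hab
    rcases ha.eq_or_lt with rfl | ha
    · obtain rfl : b = 1 := by linarith
      simpa using hy
    rcases hb.eq_or_lt with rfl | hb
    · obtain rfl : a = 1 := by linarith
      simpa using hx
    have key := hν.rpow_measure_mul_le ha hb hab (A := Prod.mk x ⁻¹' K) (B := Prod.mk y ⁻¹' K)
      (C := Prod.mk (a • x + b • y) ⁻¹' K) (measurable_prodMk_left hm) (measurable_prodMk_left hm)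
      (measurable_prodMk_left hm) fun u hu v hv => by
        simpa using hK hu hv ha.le hb.le hab
    refine lt_of_lt_of_le ?_ key
    calc ENNReal.ofReal t = ENNReal.ofReal t ^ a * ENNReal.ofReal t ^ b := by
          rw [← ENNReal.rpow_add_of_nonneg _ _ ha.le hb.le, hab, ENNReal.rpow_one]
      _ < _ := ENNReal.mul_lt_mul (ENNReal.rpow_lt_rpow hx ha) (ENNReal.rpow_lt_rpow hy hb)
  · intro x hx
    have : Prod.mk (-x) ⁻¹' K = Neg.neg ⁻¹' (Prod.mk x ⁻¹' K) := by
      ext y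
      exact ⟨fun hy => by simpa using hs _ hy, fun hy => by simpa using hs _ hy⟩
    simpa only [Set.mem_ofPred_eq, this, Measure.measure_preimage_neg] using hx

theorem MorePeaked.prod_left {μ μ' : Measure E} (h : MorePeaked μ μ') {ν : Measure F}
    [SFinite μ] [SFinite μ'] [MeasurableNeg F]
    [IsProbabilityMeasure ν] [ν.IsNegInvariant] (hν : PrekopaLeindler ν) :
    MorePeaked (ν.prod μ) (ν.prod μ') := by
  rw [← Measure.prod_swap, ← Measure.prod_swap (μ := μ')]
  exact (h.prod_right hν).map (LinearEquiv.prodComm ℝ E F).toLinearMap measurable_swap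

end

/-! ### Powers of a measure on the line -/

/-- Prepending a coordinate, as a linear map. -/
def finConsLinearMap (n : ℕ) : ℝ × (Fin n → ℝ) →ₗ[ℝ] (Fin (n + 1) → ℝ) where
  toFun p := Fin.cons p.1 p.2
  map_add' p q := by ext i; refine Fin.cases ?_ (fun j => ?_) i <;> simp
  map_smul' c p := by ext i; refine Fin.cases ?_ (fun j => ?_) i <;> simp

theorem measurePreserving_finConsLinearMap (n : ℕ) (μ : Measure ℝ) [SigmaFinite μ] :
    MeasurePreserving (finConsLinearMap n) (μ.prod (Measure.pi fun _ : Fin n => μ))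
      (Measure.pi fun _ : Fin (n + 1) => μ) := by
  have h := (measurePreserving_piFinSuccAbove (fun _ : Fin (n + 1) => μ) 0).symm
  have e : ⇑(finConsLinearMap n) =
      (MeasurableEquiv.piFinSuccAbove (fun _ : Fin (n + 1) => ℝ) 0).symm := by
    ext p i
    simp [finConsLinearMap, MeasurableEquiv.piFinSuccAbove]
  rw [e]
  exact h

theorem prekopaLeindler_pi {μ : Measure ℝ} [IsProbabilityMeasure μ] (hμ : PrekopaLeindler μ)
    (n : ℕ) : PrekopaLeindler (Measure.pi fun _ : Fin n => μ) := by
  induction n with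
  | zero =>
    intro a b ha hb hab f g h hf hg hh hf1 hg1 hfgh
    rw [Measure.pi_of_empty, lintegral_dirac, lintegral_dirac, lintegral_dirac]
    refine (hfgh _ _).trans (le_of_eq ?_)
    congr 1
    exact Subsingleton.elim _ _
  | succ n ih =>
    have h := measurePreserving_finConsLinearMap n μ
    rw [← h.map_eq]
    exact (hμ.prod ih).map _ h.measurable

/-- The factors are exchanged one at a time, through the intermediate measure μ' × μⁿ. -/
theorem MorePeaked.pi {μ μ' : Measure ℝ} [IsProbabilityMeasure μ] [IsProbabilityMeasure μ']
    [μ.IsNegInvariant] [μ'.IsNegInvariant] (h : MorePeaked μ μ') (hμ : PrekopaLeindler μ)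
    (hμ' : PrekopaLeindler μ') (n : ℕ) :
    MorePeaked (Measure.pi fun _ : Fin n => μ) (Measure.pi fun _ : Fin n => μ') := by
  induction n with
  | zero =>
    intro K _ _ _
    rw [Measure.pi_of_empty, Measure.pi_of_empty]
  | succ n ih =>
    rw [← (measurePreserving_finConsLinearMap n μ).map_eq,
      ← (measurePreserving_finConsLinearMap n μ').map_eq]
    exact ((h.prod_right (prekopaLeindler_pi hμ n)).trans (ih.prod_left hμ')).map _
      (measurePreserving_finConsLinearMap n μ).measurable

theorem lintegral_pi_prod_eq_prod_lintegral {n : ℕ} {f : Fin n → ℝ → ℝ≥0∞}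
    (hf : ∀ i, Measurable (f i)) :
    ∫⁻ x : Fin n → ℝ, ∏ i, f i (x i) = ∏ i, ∫⁻ t, f i t := by
  induction n with
  | zero => simp [volume_pi]
  | succ n ih =>
    have hm : ∀ {m : ℕ} {g : Fin m → ℝ → ℝ≥0∞}, (∀ i, Measurable (g i)) →
        Measurable fun x : Fin m → ℝ => ∏ i, g i (x i) := fun hg =>
      Finset.measurable_prod _ fun i _ => (hg i).comp (measurable_pi_apply i)
    rw [volume_pi, ← (measurePreserving_finConsLinearMap n volume).lintegral_comp (hm hf),
      Fin.prod_univ_succ, ← ih fun i => hf i.succ, ← volume_pi,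
      ← lintegral_prod_mul (hf 0).aemeasurable (hm fun i => hf i.succ).aemeasurable]
    simp [finConsLinearMap, Fin.prod_univ_succ]

/-! ### The uniform and Gaussian distributions -/

/-- The uniform distribution on `[-1/2, 1/2]`. -/
noncomputable def uniformInterval : Measure ℝ := volume.restrict (Set.Icc (-(1 / 2)) (1 / 2))

/-- The density `exp (-π x ^ 2)`. -/
noncomputable def gaussianDensity (x : ℝ) : ℝ≥0∞ := ENNReal.ofReal (Real.exp (-Real.pi * x ^ 2))

/-- The Gaussian distribution with density `exp (-π x ^ 2)`. -/
noncomputable def gaussianMeasure : Measure ℝ := volume.withDensity gaussianDensity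

theorem measurable_gaussianDensity : Measurable gaussianDensity := by
  unfold gaussianDensity
  fun_prop

theorem lintegral_gaussianDensity : ∫⁻ x, gaussianDensity x = 1 := by
  unfold gaussianDensity
  rw [← ofReal_integral_eq_lintegral_ofReal (integrable_exp_neg_mul_sq Real.pi_pos)
    (Filter.Eventually.of_forall fun x => (Real.exp_pos _).le), integral_gaussian,
    div_self Real.pi_ne_zero, Real.sqrt_one, ENNReal.ofReal_one]

theorem gaussianDensity_le_one (x : ℝ) : gaussianDensity x ≤ 1 := by
  unfold gaussianDensity
  rw [ENNReal.ofReal_le_one, Real.exp_le_one_iff]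
  have := mul_nonneg Real.pi_pos.le (sq_nonneg x)
  linarith

instance : IsProbabilityMeasure gaussianMeasure :=
  ⟨by simp [gaussianMeasure, lintegral_gaussianDensity]⟩

instance : IsProbabilityMeasure uniformInterval :=
  ⟨by simp [uniformInterval]; norm_num⟩

instance : uniformInterval.IsNegInvariant := by
  refine ⟨Measure.ext fun s hs => ?_⟩
  rw [Measure.neg, Measure.map_apply measurable_neg hs, uniformInterval,
    Measure.restrict_apply (measurable_neg hs), Measure.restrict_apply hs,
    ← Measure.measure_preimage_neg volume (s ∩ _)]
  congr 1
  ext x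
  simp [neg_le, and_comm]

instance : gaussianMeasure.IsNegInvariant := by
  refine ⟨Measure.ext fun s hs => ?_⟩
  rw [Measure.neg, Measure.map_apply measurable_neg hs, gaussianMeasure,
    withDensity_apply _ (measurable_neg hs), withDensity_apply _ hs,
    ← lintegral_indicator (measurable_neg hs), ← lintegral_indicator hs,
    ← lintegral_neg_eq_self (s.indicator _)]
  congr 1
  ext x
  simp only [Set.indicator, gaussianDensity, even_two.neg_pow]
  rfl

theorem prekopaLeindler_uniformInterval : PrekopaLeindler uniformInterval := by
  rw [uniformInterval, ← withDensity_indicator_one measurableSet_Icc]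
  refine prekopaLeindler_volume_real.withDensity (measurable_one.indicator measurableSet_Icc)
    (fun x => Set.indicator_le_self' (fun _ _ => zero_le) x) fun a b ha hb hab x y => ?_
  by_cases hx : x ∈ Set.Icc (-(1 / 2) : ℝ) (1 / 2)
  · by_cases hy : y ∈ Set.Icc (-(1 / 2) : ℝ) (1 / 2)
    · rw [Set.indicator_of_mem hx, Set.indicator_of_mem hy,
        Set.indicator_of_mem (convex_Icc _ _ hx hy ha.le hb.le hab)]
      simp
    · rw [Set.indicator_of_notMem hy]
      simp [hb]
  · rw [Set.indicator_of_notMem hx]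
    simp [ha]

theorem prekopaLeindler_gaussianMeasure : PrekopaLeindler gaussianMeasure := by
  refine prekopaLeindler_volume_real.withDensity measurable_gaussianDensity gaussianDensity_le_one
    fun a b ha hb hab x y => ?_
  unfold gaussianDensity
  rw [ENNReal.ofReal_rpow_of_pos (Real.exp_pos _), ENNReal.ofReal_rpow_of_pos (Real.exp_pos _),
    ← ENNReal.ofReal_mul (Real.rpow_nonneg (Real.exp_pos _).le _), ← Real.exp_mul, ← Real.exp_mul,
    ← Real.exp_add]
  refine ENNReal.ofReal_le_ofReal (Real.exp_le_exp.2 ?_)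
  have h := mul_nonneg (mul_nonneg Real.pi_pos.le (mul_pos ha hb).le) (sq_nonneg (x - y))
  obtain rfl : b = 1 - a := by linarith
  simp only [smul_eq_mul]
  linarith

/-- A symmetric convex subset of the line either contains [-1/2, 1/2], and has full uniform mass, or
lies inside it, where the Gaussian density is at most the uniform density 1. -/
theorem morePeaked_uniformInterval_gaussianMeasure :
    MorePeaked uniformInterval gaussianMeasure := by
  intro K hK hs hm
  by_cases hsub : Set.Icc (-(1 / 2) : ℝ) (1 / 2) ⊆ K
  · calc gaussianMeasure K ≤ 1 := prob_le_one
      _ = uniformInterval K := by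
        rw [uniformInterval, Measure.restrict_apply hm, Set.inter_eq_right.2 hsub]
        norm_num
  · obtain ⟨t, ht, htK⟩ := Set.not_subset.1 hsub
    have hKI : K ⊆ Set.Icc (-(1 / 2) : ℝ) (1 / 2) := by
      intro x hx
      by_contra hxI
      have h1 : |t| ≤ 1 / 2 := abs_le.2 ht
      have h2 : 1 / 2 < |x| := not_le.1 fun h => hxI (abs_le.1 h)
      have h3 := abs_le.1 (h1.trans h2.le)
      refine htK (hK.ordConnected.out (x := -|x|) (y := |x|) ?_ ?_ h3)
      · rcases abs_choice x with h | h <;> rw [h]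
        · exact hs x hx
        · simpa using hx
      · rcases abs_choice x with h | h <;> rw [h]
        · exact hx
        · exact hs x hx
    rw [uniformInterval, Measure.restrict_apply hm, Set.inter_eq_left.2 hKI, gaussianMeasure,
      withDensity_apply _ hm]
    calc ∫⁻ x in K, gaussianDensity x ≤ ∫⁻ _ in K, 1 := lintegral_mono gaussianDensity_le_one
      _ = volume K := by simp

theorem pi_gaussianMeasure (n : ℕ) :
    Measure.pi (fun _ : Fin n => gaussianMeasure) =
      volume.withDensity fun x : Fin n → ℝ => ∏ i, gaussianDensity (x i) := by
  refine Measure.pi_eq fun s hs => ?_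
  rw [withDensity_apply _ (MeasurableSet.univ_pi hs), ← lintegral_indicator (MeasurableSet.univ_pi hs)]
  simp only [gaussianMeasure, withDensity_apply _ (hs _), ← lintegral_indicator (hs _)]
  rw [← lintegral_pi_prod_eq_prod_lintegral fun i => measurable_gaussianDensity.indicator (hs i)]
  congr 1
  ext x
  by_cases hx : x ∈ Set.univ.pi s
  · rw [Set.indicator_of_mem hx]
    exact Finset.prod_congr rfl fun i _ => (Set.indicator_of_mem (hx i trivial) _).symm
  · rw [Set.indicator_of_notMem hx]
    simp only [Set.mem_pi, Set.mem_univ, true_implies, not_forall] at hx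
    obtain ⟨i, hi⟩ := hx
    exact (Finset.prod_eq_zero (Finset.mem_univ i) (Set.indicator_of_notMem hi _)).symm

theorem pi_uniformInterval (n : ℕ) :
    Measure.pi (fun _ : Fin n => uniformInterval) =
      volume.restrict (Set.univ.pi fun _ => Set.Icc (-(1 / 2)) (1 / 2)) := by
  rw [volume_pi, Measure.restrict_pi_pi]
  rfl

/-- A symmetric convex set meets the unit cube in a set of volume at least its Gaussian measure. -/
theorem lintegral_gaussianDensity_le_volume_inter {n : ℕ} {K : Set (Fin n → ℝ)} (hK : Convex ℝ K)
    (hs : ∀ x ∈ K, -x ∈ K) (hm : MeasurableSet K) :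
    ∫⁻ x in K, ∏ i, gaussianDensity (x i) ≤ volume (K ∩ {x | ∀ i, |x i| ≤ 1 / 2}) := by
  have := morePeaked_uniformInterval_gaussianMeasure.pi prekopaLeindler_uniformInterval
    prekopaLeindler_gaussianMeasure n K hK hs hm
  rw [pi_gaussianMeasure, pi_uniformInterval, withDensity_apply _ hm,
    Measure.restrict_apply hm] at this
  refine this.trans (le_of_eq ?_)
  congr 2
  ext x
  simp [abs_le, Pi.le_def, forall_and]

/-! ### Vaaler's theorem on central sections of the cube -/

section

variable {n : ℕ} (V : Matrix (Fin n) (Fin n) ℝ) (s : Finset (Fin n))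

/-- The product of a cube of half-side `a` in the coordinates from `s` and of the points in the
remaining coordinates which `V` sends to a cube of half-side `r / 2`. -/
def cubeCylinder (a r : ℝ) : Set (Fin n → ℝ) :=
  {y | (∀ j ∈ s, |y j| < a) ∧ ∀ i, |∑ j ∈ sᶜ, V i j * y j| ≤ r / 2}

theorem measurableSet_cubeCylinder (a r : ℝ) : MeasurableSet (cubeCylinder V s a r) := by
  have h : cubeCylinder V s a r = (⋂ j ∈ s, {y | |y j| < a}) ∩
      ⋂ i, {y | |∑ j ∈ sᶜ, V i j * y j| ≤ r / 2} := by
    ext y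
    simp [cubeCylinder]
  rw [h]
  refine MeasurableSet.inter (Finset.measurableSet_biInter _ fun j _ => ?_)
    (MeasurableSet.iInter fun i => ?_)
  · exact measurableSet_lt (by fun_prop) (by fun_prop)
  · exact measurableSet_le (by fun_prop) (by fun_prop)

theorem volume_cubeCylinder {a r : ℝ} (ha : 0 < a) (hr : 0 < r) :
    volume (cubeCylinder V s a r) =
      ENNReal.ofReal (a ^ s.card * r ^ sᶜ.card) * volume (cubeCylinder V s 1 1) := by
  set D : Fin n → ℝ := fun j => if j ∈ s then a else r with hD
  have hdet : (Matrix.diagonal D).det = a ^ s.card * r ^ sᶜ.card := by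
    rw [Matrix.det_diagonal, ← Finset.prod_mul_prod_compl s]
    congr 1
    · rw [Finset.prod_congr rfl fun j hj => if_pos hj, Finset.prod_const]
    · rw [Finset.prod_congr rfl fun j hj => if_neg (Finset.mem_compl.1 hj), Finset.prod_const]
  have hpos : 0 < a ^ s.card * r ^ sᶜ.card := by positivity
  conv_lhs => rw [← Real.smul_map_diagonal_volume_pi (D := D) (by rw [hdet]; exact hpos.ne')]
  rw [hdet, abs_of_pos hpos, Measure.smul_apply, smul_eq_mul,
    Measure.map_apply (Matrix.toLin' _).continuous_of_finiteDimensional.measurable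
      (measurableSet_cubeCylinder V s a r)]
  congr 2
  ext y
  simp only [cubeCylinder, Set.mem_preimage, Set.mem_ofPred_eq, Matrix.toLin'_apply,
    Matrix.mulVec_diagonal]
  refine and_congr (forall₂_congr fun j hj => ?_) (forall_congr' fun i => ?_)
  · rw [hD]
    simp only [hj, if_true, abs_mul, abs_of_pos ha]
    exact ⟨fun h => by nlinarith, fun h => by nlinarith⟩
  · have : ∑ j ∈ sᶜ, V i j * (D j * y j) = r * ∑ j ∈ sᶜ, V i j * y j := by
      rw [Finset.mul_sum]
      refine Finset.sum_congr rfl fun j hj => ?_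
      simp only [hD, Finset.mem_compl.1 hj, if_false]
      ring
    rw [this, abs_mul, abs_of_pos hr]
    exact ⟨fun h => by nlinarith, fun h => by nlinarith⟩

theorem setLIntegral_gaussianDensity_mulVec_le {V : Matrix (Fin n) (Fin n) ℝ} (hV : V.det ≠ 0)
    {K : Set (Fin n → ℝ)} (hK : Convex ℝ K) (hs : ∀ x ∈ K, -x ∈ K) (hm : MeasurableSet K) :
    ∫⁻ y in V.mulVec ⁻¹' K, ∏ i, gaussianDensity (V.mulVec y i) ≤
      volume (V.mulVec ⁻¹' (K ∩ {x | ∀ i, |x i| ≤ 1 / 2})) := by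
  have hVm : Measurable V.mulVec := (Matrix.toLin' V).continuous_of_finiteDimensional.measurable
  have hmap : volume.map V.mulVec = ENNReal.ofReal |V.det⁻¹| • volume :=
    Real.map_matrix_volume_pi_eq_smul_volume_pi hV
  have hC : MeasurableSet {x : Fin n → ℝ | ∀ i, |x i| ≤ 1 / 2} := by
    simp only [Set.ofPred_forall]
    exact MeasurableSet.iInter fun i => measurableSet_le (by fun_prop) (by fun_prop)
  have hρ : Measurable fun x : Fin n → ℝ => ∏ i, gaussianDensity (x i) :=
    Finset.measurable_prod _ fun i _ => measurable_gaussianDensity.comp (measurable_pi_apply i)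
  rw [← Measure.map_apply hVm (hm.inter hC), ← setLIntegral_map hm hρ hVm, hmap,
    Measure.restrict_smul, lintegral_smul_measure, Measure.smul_apply]
  exact mul_le_mul_right (lintegral_gaussianDensity_le_volume_inter hK hs hm) _

variable {V s}

/-- Pythagoras: the columns outside `s` are orthonormal and orthogonal to the columns in `s`, which
are otherwise arbitrary. -/
theorem sum_sq_mulVec (hV : ∀ j ∈ sᶜ, ∀ k, ∑ i, V i j * V i k = if j = k then 1 else 0)
    (y : Fin n → ℝ) :
    ∑ i, (V.mulVec y i) ^ 2 = ∑ i, (∑ j ∈ s, V i j * y j) ^ 2 + ∑ j ∈ sᶜ, y j ^ 2 := by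
  have h1 : ∀ i, V.mulVec y i = ∑ j ∈ s, V i j * y j + ∑ j ∈ sᶜ, V i j * y j := fun i =>
    (Finset.sum_add_sum_compl s _).symm
  have h2 : ∀ t : Finset (Fin n), ∑ i, (∑ j ∈ sᶜ, V i j * y j) * (∑ k ∈ t, V i k * y k) =
      ∑ j ∈ sᶜ, ∑ k ∈ t, if j = k then y j * y k else 0 := by
    intro t
    simp_rw [Finset.sum_mul_sum]
    rw [Finset.sum_comm]
    refine Finset.sum_congr rfl fun j hj => ?_
    rw [Finset.sum_comm]
    refine Finset.sum_congr rfl fun k _ => ?_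
    have := hV j hj k
    calc ∑ i, V i j * y j * (V i k * y k) = (∑ i, V i j * V i k) * (y j * y k) := by
          rw [Finset.sum_mul]
          exact Finset.sum_congr rfl fun i _ => by ring
      _ = _ := by rw [this]; simp
  have h3 : ∑ i, (∑ j ∈ sᶜ, V i j * y j) * (∑ k ∈ s, V i k * y k) = 0 := by
    rw [h2]
    refine Finset.sum_eq_zero fun j hj => Finset.sum_eq_zero fun k hk => if_neg ?_
    rintro rfl
    exact Finset.mem_compl.1 hj hk
  have h4 : ∑ i, (∑ j ∈ sᶜ, V i j * y j) * (∑ k ∈ sᶜ, V i k * y k) = ∑ j ∈ sᶜ, y j ^ 2 := by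
    rw [h2]
    refine Finset.sum_congr rfl fun j hj => ?_
    rw [Finset.sum_ite_eq, if_pos hj, sq]
  calc ∑ i, (V.mulVec y i) ^ 2 = ∑ i, ((∑ j ∈ s, V i j * y j) ^ 2 +
        2 * ((∑ j ∈ sᶜ, V i j * y j) * (∑ k ∈ s, V i k * y k)) +
        (∑ j ∈ sᶜ, V i j * y j) * (∑ k ∈ sᶜ, V i k * y k)) :=
        Finset.sum_congr rfl fun i _ => by rw [h1]; ring
    _ = _ := by
      rw [Finset.sum_add_distrib, Finset.sum_add_distrib, ← Finset.mul_sum, h3, h4]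
      ring

theorem abs_sum_mul_le {ε : ℝ} (hε : 0 < ε) {y : Fin n → ℝ} (hy : ∀ j ∈ s, |y j| < ε) (i : Fin n) :
    |∑ j ∈ s, V i j * y j| ≤ (∑ i, ∑ j, |V i j|) * ε := by
  calc |∑ j ∈ s, V i j * y j| ≤ ∑ j ∈ s, |V i j| * ε := by
        refine (Finset.abs_sum_le_sum_abs _ _).trans (Finset.sum_le_sum fun j hj => ?_)
        rw [abs_mul]
        exact mul_le_mul_of_nonneg_left (hy j hj).le (abs_nonneg _)
    _ ≤ ∑ j, |V i j| * ε := Finset.sum_le_sum_of_subset_of_nonneg (Finset.subset_univ _)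
        fun _ _ _ => by positivity
    _ = (∑ j, |V i j|) * ε := by rw [Finset.sum_mul]
    _ ≤ _ := by
        refine mul_le_mul_of_nonneg_right ?_ hε.le
        exact Finset.single_le_sum (f := fun i => ∑ j, |V i j|)
          (fun i _ => Finset.sum_nonneg fun j _ => abs_nonneg _) (Finset.mem_univ i)

theorem prod_gaussianDensity (y : Fin n → ℝ) (t : Finset (Fin n)) :
    ∏ i ∈ t, gaussianDensity (y i) = ENNReal.ofReal (Real.exp (-Real.pi * ∑ i ∈ t, y i ^ 2)) := by
  unfold gaussianDensity
  rw [← ENNReal.ofReal_prod_of_nonneg fun i _ => (Real.exp_pos _).le, ← Real.exp_sum,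
    Finset.mul_sum]

/-- The cube is compared with the Gaussian on the slab |y_j| < ε, j ∈ s. There the coordinates in
`s` move each entry of Vy by at most Mε, M being the sum of all |V i j|. The factor ε^|s| common to
both sides cancels, so the bound survives as ε → 0. -/
theorem mul_exp_le_mul_volume_cubeCylinder (hdet : V.det ≠ 0)
    (hV : ∀ j ∈ sᶜ, ∀ k, ∑ i, V i j * V i k = if j = k then 1 else 0) {ε : ℝ} (hε : 0 < ε) :
    ENNReal.ofReal (Real.exp (-Real.pi * (n * ((∑ i, ∑ j, |V i j|) * ε) ^ 2))) * 2 ^ s.card ≤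
      ENNReal.ofReal ((1 + 2 * ((∑ i, ∑ j, |V i j|) * ε)) ^ sᶜ.card) *
        volume (cubeCylinder V s 1 1) := by
  set M := ∑ i, ∑ j, |V i j| with hM
  have hM0 : 0 ≤ M := Finset.sum_nonneg fun i _ => Finset.sum_nonneg fun j _ => abs_nonneg _
  set K : Set (Fin n → ℝ) := {x | ∀ j ∈ s, |V⁻¹.mulVec x j| < ε} with hK
  have hpre : V.mulVec ⁻¹' K = {y | ∀ j ∈ s, |y j| < ε} := by
    ext y
    simp [hK, Matrix.mulVec_mulVec, Matrix.nonsing_inv_mul V (isUnit_iff_ne_zero.2 hdet)]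
  have hKm : MeasurableSet K := by
    have : K = ⋂ j ∈ s, {x | |V⁻¹.mulVec x j| < ε} := by ext; simp [hK]
    rw [this]
    refine Finset.measurableSet_biInter _ fun j _ => measurableSet_lt ?_ measurable_const
    have : Measurable V⁻¹.mulVec :=
      (Matrix.toLin' V⁻¹).continuous_of_finiteDimensional.measurable
    fun_prop
  have hKc : Convex ℝ K := by
    intro x hx y hy a b ha hb hab j hj
    rw [Matrix.mulVec_add, Matrix.mulVec_smul, Matrix.mulVec_smul]
    have hI := convex_Ioo (-ε) ε (abs_lt.1 (hx j hj)) (abs_lt.1 (hy j hj)) ha hb hab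
    exact abs_lt.2 hI
  have hKs : ∀ x ∈ K, -x ∈ K := fun x hx j hj => by
    rw [Matrix.mulVec_neg, Pi.neg_apply, abs_neg]
    exact hx j hj
  have key := setLIntegral_gaussianDensity_mulVec_le hdet hKc hKs hKm
  have hSm : MeasurableSet {y : Fin n → ℝ | ∀ j ∈ s, |y j| < ε} := by
    have : {y : Fin n → ℝ | ∀ j ∈ s, |y j| < ε} = ⋂ j ∈ s, {y | |y j| < ε} := by ext; simp
    rw [this]
    exact Finset.measurableSet_biInter _ fun j _ => measurableSet_lt (by fun_prop) measurable_const
  -- Dropping the coordinates in `s` enlarges the half-side from 1/2 to 1/2 + Mε.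
  have hupper : volume (V.mulVec ⁻¹' (K ∩ {x | ∀ i, |x i| ≤ 1 / 2})) ≤
      volume (cubeCylinder V s ε (1 + 2 * (M * ε))) := by
    refine measure_mono ?_
    rintro y ⟨hy, hyC⟩
    rw [← Set.mem_preimage, hpre] at hy
    refine ⟨hy, fun i => ?_⟩
    have h1 : V.mulVec y i = ∑ j ∈ s, V i j * y j + ∑ j ∈ sᶜ, V i j * y j :=
      (Finset.sum_add_sum_compl s _).symm
    have h2 := abs_le.1 (hyC i)
    have h3 := abs_le.1 (abs_sum_mul_le (V := V) hε hy i)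
    rw [h1] at h2
    exact abs_le.2 ⟨by linarith [h2.1, h3.2], by linarith [h2.2, h3.1]⟩
  -- On the slab the Gaussian weight is at least a constant times this product function, whose
  -- integral factors into 2ε for each j ∈ s and 1 for every other j.
  set φ : Fin n → ℝ → ℝ≥0∞ := fun j =>
    if j ∈ s then (Set.Ioo (-ε) ε).indicator 1 else gaussianDensity with hφ
  have hφm : ∀ j, Measurable (φ j) := by
    intro j
    by_cases hj : j ∈ s
    · simpa [hφ, hj] using measurable_one.indicator measurableSet_Ioo
    · simpa [hφ, hj] using measurable_gaussianDensity
  have hlower : ENNReal.ofReal (Real.exp (-Real.pi * (n * (M * ε) ^ 2))) *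
      ENNReal.ofReal (2 * ε) ^ s.card ≤
      ∫⁻ y in V.mulVec ⁻¹' K, ∏ i, gaussianDensity (V.mulVec y i) := by
    have hint : ∏ j, ∫⁻ t, φ j t = ENNReal.ofReal (2 * ε) ^ s.card := by
      rw [← Finset.prod_mul_prod_compl s, Finset.prod_eq_pow_card (b := ENNReal.ofReal (2 * ε)),
        Finset.prod_eq_one, mul_one]
      · intro j hj
        simp [hφ, Finset.mem_compl.1 hj, lintegral_gaussianDensity]
      · intro j hj
        simp only [hφ, hj, if_true]
        rw [lintegral_indicator_one measurableSet_Ioo, Real.volume_Ioo]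
        congr 1
        ring
    have hφpm : Measurable fun y : Fin n → ℝ => ∏ j, φ j (y j) :=
      Finset.measurable_prod _ fun j _ => (hφm j).comp (measurable_pi_apply j)
    rw [← hint, ← lintegral_pi_prod_eq_prod_lintegral hφm, ← lintegral_const_mul _ hφpm, hpre,
      ← lintegral_indicator hSm]
    refine lintegral_mono fun y => ?_
    by_cases hy : y ∈ {y : Fin n → ℝ | ∀ j ∈ s, |y j| < ε}
    · rw [Set.indicator_of_mem hy, prod_gaussianDensity, sum_sq_mulVec hV,
        ← Finset.prod_mul_prod_compl s, Finset.prod_eq_one, one_mul,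
        Finset.prod_congr rfl (g := fun j => gaussianDensity (y j)), prod_gaussianDensity,
        ← ENNReal.ofReal_mul (Real.exp_pos _).le, ← Real.exp_add]
      · refine ENNReal.ofReal_le_ofReal (Real.exp_le_exp.2 ?_)
        have h1 : ∑ i, (∑ j ∈ s, V i j * y j) ^ 2 ≤ n * (M * ε) ^ 2 := by
          calc ∑ i, (∑ j ∈ s, V i j * y j) ^ 2 ≤ ∑ _i : Fin n, (M * ε) ^ 2 :=
                Finset.sum_le_sum fun i _ => sq_le_sq.2
                  ((abs_sum_mul_le hε hy i).trans (le_abs_self _))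
            _ = _ := by simp
        have := mul_le_mul_of_nonneg_left h1 Real.pi_pos.le
        linarith
      · intro j hj
        simp [hφ, Finset.mem_compl.1 hj]
      · intro j hj
        simp only [hφ, hj, if_true]
        exact Set.indicator_of_mem (s := Set.Ioo (-ε) ε) (f := 1) (abs_lt.1 (hy j hj))
    · rw [Set.indicator_of_notMem hy]
      simp only [Set.mem_ofPred_eq, not_forall, not_lt] at hy
      obtain ⟨j, hj, hjε⟩ := hy
      rw [Finset.prod_eq_zero (Finset.mem_univ j), mul_zero]
      simp only [hφ, hj, if_true]
      exact Set.indicator_of_notMem (s := Set.Ioo (-ε) ε) (fun h => hjε.not_gt (abs_lt.2 h)) _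
  have h := (hlower.trans key).trans hupper
  have hpow : ENNReal.ofReal (2 * ε) ^ s.card = ENNReal.ofReal ε ^ s.card * 2 ^ s.card := by
    rw [ENNReal.ofReal_mul two_pos.le, mul_pow, ENNReal.ofReal_ofNat, mul_comm]
  rw [volume_cubeCylinder V s hε (by positivity), ENNReal.ofReal_mul (p := ε ^ s.card)
    (by positivity), hpow, ENNReal.ofReal_pow hε.le, mul_left_comm (ENNReal.ofReal (Real.exp _)),
    mul_assoc (ENNReal.ofReal ε ^ s.card)] at h
  have e0 : ENNReal.ofReal ε ^ s.card ≠ 0 := pow_ne_zero _ (by simpa using hε)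
  have e1 : ENNReal.ofReal ε ^ s.card ≠ ∞ := ENNReal.pow_ne_top ENNReal.ofReal_ne_top
  exact (ENNReal.mul_le_mul_iff_right e0 e1).1 h

/-- Vaaler's theorem: central sections of the unit cube have volume at least one. -/
theorem two_pow_le_volume_cubeCylinder (hdet : V.det ≠ 0)
    (hV : ∀ j ∈ sᶜ, ∀ k, ∑ i, V i j * V i k = if j = k then 1 else 0) :
    2 ^ s.card ≤ volume (cubeCylinder V s 1 1) := by
  set M := ∑ i, ∑ j, |V i j| with hM
  have h1 : Filter.Tendsto (fun ε : ℝ => ENNReal.ofReal (Real.exp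
      (-Real.pi * (n * (M * ε) ^ 2))) * 2 ^ s.card) (nhdsWithin 0 (Set.Ioi 0))
      (nhds (1 * 2 ^ s.card)) := by
    refine ENNReal.Tendsto.mul_const ?_ (Or.inl one_ne_zero)
    have : Filter.Tendsto (fun ε : ℝ => ENNReal.ofReal (Real.exp
      (-Real.pi * (n * (M * ε) ^ 2)))) (nhds 0)
      (nhds (ENNReal.ofReal (Real.exp (-Real.pi * (n * (M * 0) ^ 2))))) :=
      (ENNReal.continuous_ofReal.comp (by fun_prop)).tendsto 0
    simpa using this.mono_left nhdsWithin_le_nhds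
  have h2 : Filter.Tendsto (fun ε : ℝ => ENNReal.ofReal ((1 + 2 * (M * ε)) ^ sᶜ.card) *
      volume (cubeCylinder V s 1 1)) (nhdsWithin 0 (Set.Ioi 0))
      (nhds (1 * volume (cubeCylinder V s 1 1))) := by
    refine ENNReal.Tendsto.mul_const ?_ (Or.inl one_ne_zero)
    have : Filter.Tendsto (fun ε : ℝ => ENNReal.ofReal ((1 + 2 * (M * ε)) ^ sᶜ.card)) (nhds 0)
      (nhds (ENNReal.ofReal ((1 + 2 * (M * 0)) ^ sᶜ.card))) :=
      (ENNReal.continuous_ofReal.comp (by fun_prop)).tendsto 0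
    simpa using this.mono_left nhdsWithin_le_nhds
  rw [one_mul] at h1 h2
  exact le_of_tendsto_of_tendsto h1 h2 (eventually_nhdsWithin_of_forall fun ε hε =>
    mul_exp_le_mul_volume_cubeCylinder hdet hV hε)

end

/-! ### Bivector coordinates and Gram determinants -/

section

theorem orderEmbOfFin_pair {α : Type*} [LinearOrder α] {i j : α} (hij : i < j)
    (h : ({i, j} : Finset α).card = 2) :
    ({i, j} : Finset α).orderEmbOfFin h 0 = i ∧ ({i, j} : Finset α).orderEmbOfFin h 1 = j := by
  have h0 := Finset.orderEmbOfFin_mem {i, j} h 0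
  have h1 := Finset.orderEmbOfFin_mem {i, j} h 1
  have hlt : ({i, j} : Finset α).orderEmbOfFin h 0 < ({i, j} : Finset α).orderEmbOfFin h 1 :=
    (Finset.orderEmbOfFin _ h).strictMono (by decide)
  rw [Finset.mem_insert, Finset.mem_singleton] at h0 h1
  rcases h0 with h0 | h0 <;> rcases h1 with h1 | h1
  · exact absurd hlt (by rw [h0, h1]; exact lt_irrefl _)
  · exact ⟨h0, h1⟩
  · exact absurd hlt (by rw [h0, h1]; exact hij.not_gt)
  · exact absurd hlt (by rw [h0, h1]; exact lt_irrefl _)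

theorem bivectorCoord_ιMulti {d : ℕ} (z₁ z₂ : EuclideanSpace ℝ (Fin d)) {i j : Fin d}
    (hij : i < j) :
    bivectorCoord (exteriorPower.ιMulti ℝ 2 ![z₁, z₂]) i j hij = z₁ i * z₂ j - z₁ j * z₂ i := by
  have h := orderEmbOfFin_pair hij (Finset.card_pair hij.ne)
  rw [bivectorCoord, exteriorPower.basis_repr_apply, exteriorPower.ιMultiDual_apply_ιMulti,
    Matrix.det_fin_two]
  simp only [Set.powersetCard.ofFinEmbEquiv_symm_apply, Matrix.of_apply]
  rw [h.1, h.2]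
  simp

/-- The Lagrange identity. -/
theorem sum_sq_mul_sum_sq_sub {d : ℕ} (u v : Fin d → ℝ) :
    (∑ i, u i ^ 2) * (∑ i, v i ^ 2) - (∑ i, u i * v i) ^ 2 =
      (∑ i, ∑ j, (u i * v j - u j * v i) ^ 2) / 2 := by
  have h : ∑ i, ∑ j, (u i * v j - u j * v i) ^ 2 =
      ∑ i, ∑ j, u i ^ 2 * v j ^ 2 + ∑ i, ∑ j, v i ^ 2 * u j ^ 2 -
        2 * ∑ i, ∑ j, (u i * v i) * (u j * v j) := by
    simp only [Finset.mul_sum, ← Finset.sum_add_distrib, ← Finset.sum_sub_distrib]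
    exact Finset.sum_congr rfl fun i _ => Finset.sum_congr rfl fun j _ => by ring
  rw [h, ← Finset.sum_mul_sum, ← Finset.sum_mul_sum, ← Finset.sum_mul_sum]
  ring

theorem sum_sq_mul_sum_sq_sub_le {d : ℕ} (u v : Fin d → ℝ) {P : ℝ}
    (h : ∀ i j, i < j → |u i * v j - u j * v i| ≤ P) :
    (∑ i, u i ^ 2) * (∑ i, v i ^ 2) - (∑ i, u i * v i) ^ 2 ≤ (d : ℝ) * (d - 1) / 2 * P ^ 2 := by
  -- The diagonal terms vanish, so only d² - d of the d² terms count; this is the source of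
  -- d(d-1)/2.
  have h1 : ∀ i j, (u i * v j - u j * v i) ^ 2 ≤ P ^ 2 - if i = j then P ^ 2 else 0 := by
    intro i j
    rcases lt_trichotomy i j with hij | rfl | hij
    · rw [if_neg hij.ne, sub_zero]
      exact sq_le_sq.2 ((h i j hij).trans (le_abs_self P))
    · simp
    · rw [if_neg hij.ne', sub_zero]
      have := sq_le_sq.2 ((h j i hij).trans (le_abs_self P))
      linarith
  have h2 : ∑ i : Fin d, ∑ j : Fin d, (u i * v j - u j * v i) ^ 2 ≤ (d : ℝ) * (d - 1) * P ^ 2 := by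
    refine (Finset.sum_le_sum fun i _ => Finset.sum_le_sum fun j _ => h1 i j).trans (le_of_eq ?_)
    simp
    ring
  rw [sum_sq_mul_sum_sq_sub]
  linarith

/-- Two vectors can be completed by orthonormal vectors orthogonal to both of them, so that the
squared determinant is their Gram determinant. -/
theorem exists_matrix_det_sq_eq {d : ℕ} {p q : Fin d} (hpq : p < q) (hq : ∀ i, i < q → i = p)
    (u v : Fin d → ℝ) :
    ∃ M : Matrix (Fin d) (Fin d) ℝ, M p = u ∧ M q = v ∧
      M.det ^ 2 = (∑ i, u i ^ 2) * (∑ i, v i ^ 2) - (∑ i, u i * v i) ^ 2 ∧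
      ∀ j, j ≠ p → j ≠ q → ∀ k, ∑ i, M j i * M k i = if j = k then 1 else 0 := by
  have hp : ∀ j, j ≠ p → p < j := fun j hj => by
    by_contra hjp
    have : j < p := lt_of_le_of_ne (not_lt.1 hjp) hj
    exact hj (hq j (this.trans hpq))
  have hq' : ∀ j, j ≠ p → j ≠ q → q < j := fun j hj hjq => by
    by_contra h
    exact hj (hq j (lt_of_le_of_ne (not_lt.1 h) hjq))
  -- As p and q are the two smallest indices, Gram–Schmidt treats u and v first. The zeros elsewhere
  -- are placeholders, replaced by the vectors completing an orthonormal basis; u and v may be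
  -- dependent.
  set f : Fin d → EuclideanSpace ℝ (Fin d) := fun i =>
    if i = p then WithLp.toLp 2 u else if i = q then WithLp.toLp 2 v else 0 with hf
  have hfp : f p = WithLp.toLp 2 u := by simp [hf]
  have hfq : f q = WithLp.toLp 2 v := by simp [hf, hpq.ne']
  set b := InnerProductSpace.gramSchmidtOrthonormalBasis (𝕜 := ℝ) (by simp) f with hb
  have hbf : ∀ i j, i < j → inner ℝ (b j) (f i) = 0 := fun i j hij =>
    InnerProductSpace.gramSchmidtOrthonormalBasis_inv_triangular _ f hij
  have hbb : ∀ i j, inner ℝ (b i) (b j) = if i = j then (1 : ℝ) else 0 :=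
    orthonormal_iff_ite.1 b.orthonormal
  set g : Fin d → EuclideanSpace ℝ (Fin d) := fun i => if i = p ∨ i = q then f i else b i with hg
  have hgp : g p = f p := by simp [hg]
  have hgq : g q = f q := by simp [hg]
  have hgb : ∀ i, i ≠ p → i ≠ q → g i = b i := fun i h1 h2 => by simp [hg, h1, h2]
  have hbg : ∀ i j, i < j → inner ℝ (b j) (g i) = 0 := by
    intro i j hij
    by_cases h : i = p ∨ i = q
    · rw [hg]
      simpa [h] using hbf i j hij
    · push Not at h
      rw [hgb i h.1 h.2, hbb, if_neg hij.ne']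
  have hinner : ∀ x y : EuclideanSpace ℝ (Fin d), inner ℝ x y = ∑ i, x i * y i := fun x y => by
    simp [PiLp.inner_apply, mul_comm]
  set M : Matrix (Fin d) (Fin d) ℝ := Matrix.of fun i => (g i).ofLp with hM
  set B : Matrix (Fin d) (Fin d) ℝ := Matrix.of fun i => (b i).ofLp with hB
  have hBB : B * B.transpose = 1 := by
    ext i j
    rw [Matrix.mul_apply, Matrix.one_apply, ← hbb, hinner]
    rfl
  have hdetB : B.det ^ 2 = 1 := by
    have := congrArg Matrix.det hBB
    rwa [Matrix.det_mul, Matrix.det_transpose, Matrix.det_one, ← sq] at this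
  -- In the basis `b` the matrix M is lower triangular, with diagonal entries 1 away from p and q.
  have hdet : M.det * B.det = inner ℝ (b p) (g p) * inner ℝ (b q) (g q) := by
    have h1 : ∀ i j, (M * B.transpose) i j = inner ℝ (b j) (g i) := fun i j => by
      rw [real_inner_comm, hinner, Matrix.mul_apply]
      rfl
    have h2 : (M * B.transpose).det = ∏ i, inner ℝ (b i) (g i) := by
      rw [Matrix.det_of_isLowerTriangular]
      · exact Finset.prod_congr rfl fun i _ => h1 i i
      · intro i j hij
        rw [h1]
        exact hbg i j hij
    rw [Matrix.det_mul, Matrix.det_transpose] at h2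
    rw [h2, ← Finset.prod_subset (Finset.subset_univ {p, q}), Finset.prod_pair hpq.ne]
    intro i _ hi
    simp only [Finset.mem_insert, Finset.mem_singleton, not_or] at hi
    rw [hgb i hi.1 hi.2, hbb, if_pos rfl]
  have hu : ∀ x : EuclideanSpace ℝ (Fin d), inner ℝ x (g p) = inner ℝ x (b p) * inner ℝ (b p) (g p) := by
    intro x
    rw [← b.sum_inner_mul_inner x (g p)]
    refine Finset.sum_eq_single p (fun j _ hj => ?_) (by simp)
    rw [hbg p j (hp j hj), mul_zero]
  have hv : inner ℝ (g q) (g q) = inner ℝ (g q) (b p) * inner ℝ (b p) (g q) +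
      inner ℝ (g q) (b q) * inner ℝ (b q) (g q) := by
    rw [← b.sum_inner_mul_inner (g q) (g q), ← Finset.sum_subset (Finset.subset_univ {p, q}),
      Finset.sum_pair hpq.ne]
    intro j _ hj
    simp only [Finset.mem_insert, Finset.mem_singleton, not_or] at hj
    rw [hbg q j (hq' j hj.1 hj.2), mul_zero]
  have hgpu : ∀ i, g p i = u i := fun i => by rw [hgp, hfp]
  have hgqv : ∀ i, g q i = v i := fun i => by rw [hgq, hfq]
  have hgram : M.det ^ 2 = (∑ i, u i ^ 2) * (∑ i, v i ^ 2) - (∑ i, u i * v i) ^ 2 := by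
    have e1 : ∑ i, u i ^ 2 = inner ℝ (g p) (g p) := by simp only [hinner, hgpu, sq]
    have e2 : ∑ i, v i ^ 2 = inner ℝ (g q) (g q) := by simp only [hinner, hgqv, sq]
    have e3 : ∑ i, u i * v i = inner ℝ (g q) (g p) := by
      simp only [hinner, hgpu, hgqv, mul_comm]
    have e4 : M.det ^ 2 = (M.det * B.det) ^ 2 := by rw [mul_pow, hdetB, mul_one]
    rw [e1, e2, e3, e4, hdet, hu (g p), hu (g q), hv, real_inner_comm (g p) (b p),
      real_inner_comm (g q) (b p), real_inner_comm (g q) (b q)]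
    ring
  refine ⟨M, ?_, ?_, hgram, fun j hjp hjq k => ?_⟩
  · ext i; exact hgpu i
  · ext i; exact hgqv i
  · have h1 : ∑ i, M j i * M k i = inner ℝ (b j) (g k) := by
      rw [hinner, ← hgb j hjp hjq]
      rfl
    rw [h1]
    by_cases hk : k = p ∨ k = q
    · rw [if_neg (by rintro rfl; tauto)]
      rcases hk with rfl | rfl
      · exact hbg _ _ (hp j hjp)
      · exact hbg _ _ (hq' j hjp hjq)
    · push Not at hk
      rw [hgb k hk.1 hk.2, hbb]

end

/-! ### Minkowski's theorem and the small lattice vector -/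

theorem convex_cubeCylinder {n : ℕ} (V : Matrix (Fin n) (Fin n) ℝ) (s : Finset (Fin n))
    (a r : ℝ) : Convex ℝ (cubeCylinder V s a r) := by
  intro x hx y hy α β hα hβ hαβ
  refine ⟨fun j hj => ?_, fun i => ?_⟩
  · exact abs_lt.2 (convex_Ioo (-a) a (abs_lt.1 (hx.1 j hj)) (abs_lt.1 (hy.1 j hj)) hα hβ hαβ)
  · have h := convex_Icc (-(r / 2)) (r / 2) (abs_le.1 (hx.2 i)) (abs_le.1 (hy.2 i)) hα hβ hαβ
    have e : ∑ j ∈ sᶜ, V i j * (α • x + β • y) j =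
        α • ∑ j ∈ sᶜ, V i j * x j + β • ∑ j ∈ sᶜ, V i j * y j := by
      simp only [smul_eq_mul, Finset.mul_sum, ← Finset.sum_add_distrib, Pi.add_apply, Pi.smul_apply]
      exact Finset.sum_congr rfl fun j _ => by ring
    rw [e]
    exact abs_le.2 h

theorem neg_mem_cubeCylinder {n : ℕ} {V : Matrix (Fin n) (Fin n) ℝ} {s : Finset (Fin n)}
    {a r : ℝ} {x : Fin n → ℝ} (hx : x ∈ cubeCylinder V s a r) : -x ∈ cubeCylinder V s a r := by
  refine ⟨fun j hj => ?_, fun i => ?_⟩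
  · simpa using hx.1 j hj
  · simpa using hx.2 i

/-- Minkowski's theorem for the preimage of a measurable convex symmetric set of `ℝ^d` under an
invertible matrix. -/
theorem exists_ne_zero_mem_of_two_pow_mul_abs_det_lt {d : ℕ}
    (Λ : Submodule ℤ (EuclideanSpace ℝ (Fin d))) [DiscreteTopology Λ] [IsZLattice ℝ Λ]
    (hΛ : ZLattice.covolume Λ = 1) {A : Matrix (Fin d) (Fin d) ℝ} (hA : A.det ≠ 0)
    {K : Set (Fin d → ℝ)} (hK : Convex ℝ K) (hs : ∀ x ∈ K, -x ∈ K)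
    (hm : MeasurableSet K) (hvol : 2 ^ d * ENNReal.ofReal |A.det| < volume K) :
    ∃ z ∈ Λ, z ≠ 0 ∧ A.mulVec z.ofLp ∈ K := by
  set S : Set (EuclideanSpace ℝ (Fin d)) := WithLp.ofLp ⁻¹' (A.mulVec ⁻¹' K) with hS
  have hSvol : volume S = ENNReal.ofReal |A.det|⁻¹ * volume K := by
    have hAm : Measurable A.mulVec := (Matrix.mulVecLin A).continuous_of_finiteDimensional.measurable
    rw [hS, (PiLp.volume_preserving_ofLp (Fin d)).measure_preimage (hAm hm).nullMeasurableSet,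
      ← abs_inv, ← smul_eq_mul, ← Measure.smul_apply, ← Real.map_matrix_volume_pi_eq_smul_volume_pi hA,
      Measure.map_apply (f := Matrix.toLin' A) hAm hm]
    rfl
  have fund := ZLattice.isAddFundamentalDomain (Module.Free.chooseBasis ℤ Λ)
    (volume : Measure (EuclideanSpace ℝ (Fin d)))
  have hF := ZLattice.covolume_eq_measure_fundamentalDomain Λ volume fund
  rw [hΛ, Measure.real, eq_comm, ENNReal.toReal_eq_one_iff] at hF
  have : Countable Λ.toAddSubgroup := inferInstanceAs (Countable Λ)
  have hSs : ∀ x ∈ S, -x ∈ S := fun x hx => by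
    rw [hS, Set.mem_preimage, Set.mem_preimage, WithLp.ofLp_neg, Matrix.mulVec_neg]
    exact hs _ hx
  have hSc : Convex ℝ S := (hK.linear_preimage (Matrix.mulVecLin A)).linear_preimage
    (WithLp.linearEquiv 2 ℝ (Fin d → ℝ)).toLinearMap
  obtain ⟨x, hx0, hxS⟩ := exists_ne_zero_mem_lattice_of_measure_mul_two_pow_lt_measure
    (L := Λ.toAddSubgroup) fund hSs hSc (by
      have h0 : ENNReal.ofReal |A.det| ≠ 0 := by simpa using hA
      rw [hF, hSvol, one_mul, finrank_euclideanSpace_fin, ENNReal.ofReal_inv_of_pos (abs_pos.2 hA),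
        mul_comm, ← div_eq_mul_inv, ENNReal.lt_div_iff_mul_lt (Or.inl h0)
        (Or.inl ENNReal.ofReal_ne_top)]
      exact hvol)
  exact ⟨x, x.2, fun h => hx0 (Subtype.ext h), hxS⟩

/-- Minkowski's theorem with a strict volume inequality only reaches r > c. The box for c + 1 holds
finitely many lattice points; if each nonzero one violated the bound for c, all would violate it for
some r slightly above c. -/
theorem exists_ne_zero_mem_of_forall_gt {d : ℕ} (Λ : Submodule ℤ (EuclideanSpace ℝ (Fin d)))
    [DiscreteTopology Λ] {η : Fin d → ℝ} (hη : ∀ i, 0 < η i) {c : ℝ}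
    (h : ∀ r, c < r → ∃ z ∈ Λ, z ≠ 0 ∧ ∀ i, |z i| ≤ r * η i) :
    ∃ z ∈ Λ, z ≠ 0 ∧ ∀ i, |z i| ≤ c * η i := by
  by_contra! hc
  set T : Set (EuclideanSpace ℝ (Fin d)) := {z | ∀ i, |z i| ≤ (c + 1) * η i} ∩ Λ with hT
  have hfin : T.Finite := by
    have : DiscreteTopology Λ.toAddSubgroup := inferInstanceAs (DiscreteTopology Λ)
    refine Metric.finite_isBounded_inter_isClosed DiscreteTopology.isDiscrete ?_
      (AddSubgroup.isClosed_of_discrete (H := Λ.toAddSubgroup))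
    refine (Metric.isBounded_closedBall (x := (0 : EuclideanSpace ℝ (Fin d)))
      (r := ∑ i, (c + 1) * η i)).subset fun z hz => ?_
    rw [mem_closedBall_zero_iff]
    have : z = ∑ i, z i • EuclideanSpace.basisFun (Fin d) ℝ i := by
      have := (EuclideanSpace.basisFun (Fin d) ℝ).sum_repr z
      simpa using this.symm
    rw [this]
    refine (norm_sum_le _ _).trans (Finset.sum_le_sum fun i _ => ?_)
    rw [norm_smul, OrthonormalBasis.norm_eq_one, mul_one]
    exact hz i
  have hev : ∀ᶠ r in nhdsWithin c (Set.Ioi c), ∀ z ∈ T, z ≠ 0 → ∃ i, r * η i < |z i| := by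
    rw [Filter.eventually_all_finite hfin]
    intro z hz
    by_cases hz0 : z = 0
    · simp [hz0]
    obtain ⟨i, hi⟩ := hc z hz.2 hz0
    have : Filter.Tendsto (fun r => r * η i) (nhdsWithin c (Set.Ioi c)) (nhds (c * η i)) :=
      ((continuous_id.mul continuous_const).tendsto c).mono_left nhdsWithin_le_nhds
    filter_upwards [this.eventually_lt_const hi] with r hr _ using ⟨i, hr⟩
  have hlt : ∀ᶠ r in nhdsWithin c (Set.Ioi c), r < c + 1 :=
    (eventually_lt_nhds (lt_add_one c)).filter_mono nhdsWithin_le_nhds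
  obtain ⟨r, hr, hr1, hcr⟩ := (hev.and (hlt.and self_mem_nhdsWithin)).exists
  obtain ⟨z, hz, hz0, hzr⟩ := h r hcr
  obtain ⟨i, hi⟩ := hr z ⟨fun i => (hzr i).trans
    (mul_le_mul_of_nonneg_right hr1.le (hη i).le), hz⟩ hz0
  exact hi.not_ge (hzr i)

theorem exists_bivectorCoord_ne_zero {d : ℕ} {Z : ⋀[ℝ]^2 (EuclideanSpace ℝ (Fin d))}
    (hZ : Z ≠ 0) : ∃ (i j : Fin d) (hij : i < j), bivectorCoord Z i j hij ≠ 0 := by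
  by_contra! h
  refine hZ (((EuclideanSpace.basisFun (Fin d) ℝ).toBasis.exteriorPower 2).repr.map_eq_zero_iff.1
    (Finsupp.ext fun ⟨t, ht⟩ => ?_))
  obtain ⟨i, j, hij, rfl⟩ := Finset.card_eq_two.1 ht
  rcases lt_or_gt_of_ne hij with hlt | hlt
  · exact h i j hlt
  · have := h j i hlt
    simp only [bivectorCoord, Finset.pair_comm j i] at this
    exact this

/-- A pair of vectors of the dual lattice with small bivector yields a small lattice vector. -/
theorem exists_ne_zero_mem_abs_le_mul {d : ℕ} (hd : 3 ≤ d)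
    (Λ : Submodule ℤ (EuclideanSpace ℝ (Fin d))) [DiscreteTopology Λ] [IsZLattice ℝ Λ]
    (hΛ : ZLattice.covolume Λ = 1) {η : Fin d → ℝ} (hη : ∀ i, 0 < η i)
    {z₁ z₂ : EuclideanSpace ℝ (Fin d)} (hz₁ : z₁ ∈ dualLattice Λ) (hz₂ : z₂ ∈ dualLattice Λ)
    (hne : ∃ i j, z₁ i * z₂ j - z₁ j * z₂ i ≠ 0) {r : ℝ} (hr : 0 < r)
    (hrd : ∀ i j, i < j → |z₁ i * z₂ j - z₁ j * z₂ i| ≤ 1 / (η i * η j) * ∏ k, η k)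
    (hdr : (d : ℝ) * (d - 1) / 2 < (r ^ (d - 2)) ^ 2) :
    ∃ z ∈ Λ, z ≠ 0 ∧ ∀ i, |z i| ≤ r * η i := by
  set P := ∏ k, η k with hP
  have hP0 : 0 < P := Finset.prod_pos fun i _ => hη i
  set p : Fin d := ⟨0, by omega⟩ with hp
  set q : Fin d := ⟨1, by omega⟩ with hq
  have hpq : p < q := by simp [hp, hq]
  set u : Fin d → ℝ := fun i => η i * z₁ i with hu
  set v : Fin d → ℝ := fun i => η i * z₂ i with hv
  have huv : ∀ i j, u i * v j - u j * v i = η i * η j * (z₁ i * z₂ j - z₁ j * z₂ i) :=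
    fun i j => by simp only [hu, hv]; ring
  obtain ⟨M, hMp, hMq, hMdet, hMrow⟩ := exists_matrix_det_sq_eq hpq
    (fun i hi => Fin.ext (by simpa [hp, hq, Fin.lt_def] using hi)) u v
  have hle := sum_sq_mul_sum_sq_sub_le u v (P := P) fun i j hij => by
    have hpos := mul_pos (hη i) (hη j)
    rw [huv, abs_mul, abs_of_pos hpos]
    calc η i * η j * |z₁ i * z₂ j - z₁ j * z₂ i| ≤ η i * η j * (1 / (η i * η j) * P) :=
          mul_le_mul_of_nonneg_left (hrd i j hij) hpos.le
      _ = P := by rw [← mul_assoc, mul_one_div_cancel hpos.ne', one_mul]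
  have hdet0 : M.det ≠ 0 := by
    obtain ⟨i, j, hij⟩ := hne
    have hpos : 0 < M.det ^ 2 := by
      rw [hMdet, sum_sq_mul_sum_sq_sub]
      refine half_pos (Finset.sum_pos' (fun i _ => Finset.sum_nonneg fun j _ => sq_nonneg _)
        ⟨i, Finset.mem_univ i, Finset.sum_pos' (fun j _ => sq_nonneg _)
          ⟨j, Finset.mem_univ j, ?_⟩⟩)
      rw [huv]
      exact sq_pos_of_ne_zero (mul_ne_zero (mul_pos (hη i) (hη j)).ne' hij)
    exact fun h => by simp [h] at hpos
  have hunit : IsUnit M.det := isUnit_iff_ne_zero.2 hdet0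
  set s : Finset (Fin d) := {p, q} with hs
  have hcard : s.card = 2 := Finset.card_pair hpq.ne
  have hmem : ∀ j ∈ sᶜ, j ≠ p ∧ j ≠ q := fun j hj => by simpa [hs] using hj
  -- A row M_j outside `s` is a unit vector orthogonal to all other rows, so M sends it to e_j.
  -- Hence M⁻¹ satisfies the column condition of Vaaler's theorem.
  have hcol : ∀ j ∈ sᶜ, ∀ i, M⁻¹ i j = M j i := by
    intro j hj i
    have h1 : M.mulVec (M j) = Pi.single j 1 := by
      ext k
      rw [Pi.single_apply, Matrix.mulVec, dotProduct]
      simp only [mul_comm (M k _), hMrow j (hmem j hj).1 (hmem j hj).2 k, eq_comm]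
    have h2 : M⁻¹.mulVec (M.mulVec (M j)) = M j := by
      rw [Matrix.mulVec_mulVec, Matrix.nonsing_inv_mul M hunit, Matrix.one_mulVec]
    rw [h1, Matrix.mulVec_single_one] at h2
    exact congrFun h2 i
  have hvaaler := two_pow_le_volume_cubeCylinder (V := M⁻¹) (s := s)
    (by rw [Matrix.det_nonsing_inv, Ring.inverse_eq_inv']; exact inv_ne_zero hdet0)
    fun j hj k => by
      have h := congrFun (congrFun (Matrix.mul_nonsing_inv M hunit) j) k
      rw [Matrix.mul_apply, Matrix.one_apply] at h
      simp only [hcol j hj, h]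
  set A : Matrix (Fin d) (Fin d) ℝ := M * Matrix.diagonal fun i => (η i)⁻¹ with hA
  have hAdet : A.det = M.det * P⁻¹ := by
    rw [hA, Matrix.det_mul, Matrix.det_diagonal, Finset.prod_inv_distrib]
  have hAlt : |A.det| < r ^ (d - 2) := by
    refine abs_lt_of_sq_lt_sq ?_ (by positivity)
    refine lt_of_le_of_lt ?_ hdr
    rw [hAdet, mul_pow, hMdet, inv_pow, ← div_eq_mul_inv, div_le_iff₀ (by positivity)]
    exact hle
  have hd2 : sᶜ.card = d - 2 := by rw [Finset.card_compl, hcard, Fintype.card_fin]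
  -- The side 2r gives the cube half-side r; the strict bound 1 on the coordinates in `s` will force
  -- integers to vanish.
  obtain ⟨z, hz, hz0, hzK⟩ := exists_ne_zero_mem_of_two_pow_mul_abs_det_lt Λ hΛ (A := A)
    (by rw [hAdet]; exact mul_ne_zero hdet0 (inv_ne_zero hP0.ne'))
    (convex_cubeCylinder M⁻¹ s 1 (2 * r)) (fun x => neg_mem_cubeCylinder)
    (measurableSet_cubeCylinder M⁻¹ s 1 (2 * r)) (by
      rw [volume_cubeCylinder _ _ one_pos (by positivity), hcard, hd2, one_pow, one_mul]
      rw [hcard] at hvaaler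
      refine lt_of_lt_of_le ?_ (mul_le_mul_right hvaaler _)
      have e1 : (2 : ℝ≥0∞) ^ d = ENNReal.ofReal (2 ^ d) := by
        rw [ENNReal.ofReal_pow two_pos.le, ENNReal.ofReal_ofNat]
      have e2 : (2 : ℝ≥0∞) ^ 2 = ENNReal.ofReal (2 ^ 2) := by
        rw [ENNReal.ofReal_pow two_pos.le, ENNReal.ofReal_ofNat]
      rw [e1, e2, ← ENNReal.ofReal_mul (by positivity), ← ENNReal.ofReal_mul (by positivity),
        ENNReal.ofReal_lt_ofReal_iff (by positivity)]
      calc (2 : ℝ) ^ d * |A.det| < 2 ^ d * r ^ (d - 2) := by gcongr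
        _ = (2 * r) ^ (d - 2) * 2 ^ 2 := by
          rw [mul_pow, mul_right_comm, ← pow_add, Nat.sub_add_cancel (by omega)])
  set x : Fin d → ℝ := fun i => (η i)⁻¹ * z i with hx
  have hAz : A.mulVec z.ofLp = M.mulVec x := by
    rw [hA, ← Matrix.mulVec_mulVec]
    congr 1
    ext i
    rw [Matrix.mulVec_diagonal]
  rw [hAz] at hzK
  -- The scalings by η and η⁻¹ cancel, so this coordinate is the integer ⟨w, z⟩, of absolute value
  -- below 1.
  have hzero : ∀ (j : Fin d) (w : EuclideanSpace ℝ (Fin d)), j ∈ s → w ∈ dualLattice Λ →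
      (M j = fun i => η i * w i) → M.mulVec x j = 0 := by
    intro j w hj hw hMj
    obtain ⟨m, hm⟩ := (mem_dualLattice Λ w).1 hw z hz
    have e : M.mulVec x j = m := by
      rw [hm, Matrix.mulVec, dotProduct, hMj, PiLp.inner_apply]
      refine Finset.sum_congr rfl fun i _ => ?_
      have := (hη i).ne'
      simp only [hx, RCLike.inner_apply, conj_trivial]
      field_simp
    have hlt := hzK.1 j hj
    rw [e] at hlt ⊢
    have : m = 0 := Int.abs_lt_one_iff.1 (by exact_mod_cast hlt)
    simp [this]
  -- With the coordinates in `s` zero, x equals its projection, to which the cube condition applies.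
  have hsum : ∀ i, ∑ j ∈ sᶜ, M⁻¹ i j * M.mulVec x j = x i := by
    intro i
    have h1 : M⁻¹.mulVec (M.mulVec x) i = x i := by
      rw [Matrix.mulVec_mulVec, Matrix.nonsing_inv_mul M hunit, Matrix.one_mulVec]
    rw [← h1]
    refine Finset.sum_subset (Finset.subset_univ _) fun j _ hj => ?_
    have hj' : j ∈ s := by simpa using hj
    have : M.mulVec x j = 0 := by
      rcases Finset.mem_insert.1 hj' with h | h
      · exact hzero j z₁ hj' hz₁ (by rw [h, hMp])
      · exact hzero j z₂ hj' hz₂ (by rw [Finset.mem_singleton.1 h, hMq])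
    rw [this, mul_zero]
  refine ⟨z, hz, hz0, fun i => ?_⟩
  have h := hzK.2 i
  rw [hsum i, mul_div_cancel_left₀ _ two_ne_zero, hx, abs_mul, abs_inv, abs_of_pos (hη i),
    inv_mul_le_iff₀ (hη i), mul_comm] at h
  exact h

theorem theoremt (d : ℕ) (hd : 3 ≤ d)
    (Λ : Submodule ℤ (EuclideanSpace ℝ (Fin d))) [DiscreteTopology Λ] [IsZLattice ℝ Λ]
    (hΛ : ZLattice.covolume Λ = 1)
    (η : Fin d → ℝ) (hη : ∀ i, 0 < η i)
    (h : ∃ Z ∈ secondPseudocompound η ∩ dualDecomposables Λ, Z ≠ 0) :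
    ∃ z ∈ (((d : ℝ) * ((d : ℝ) - 1) / 2) ^ (1 / (2 * ((d : ℝ) - 2))) • coordBox η) ∩
      (Λ : Set (EuclideanSpace ℝ (Fin d))), z ≠ 0 := by
  obtain ⟨Z, ⟨hZ, z₁, hz₁, z₂, hz₂, rfl⟩, hZ0⟩ := h
  set D : ℝ := (d : ℝ) * ((d : ℝ) - 1) / 2 with hD
  set c : ℝ := D ^ (1 / (2 * ((d : ℝ) - 2))) with hc
  have hd3 : (3 : ℝ) ≤ d := by exact_mod_cast hd
  have hD0 : 0 < D := by
    rw [hD]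
    have : 0 < (d : ℝ) * (d - 1) := mul_pos (by linarith) (by linarith)
    linarith
  have hc0 : 0 < c := Real.rpow_pos_of_pos hD0 _
  have hcd : (c ^ (d - 2)) ^ 2 = D := by
    have hne : (d : ℝ) - 2 ≠ 0 := by linarith
    rw [← pow_mul, hc, ← Real.rpow_natCast, ← Real.rpow_mul hD0.le, Nat.cast_mul,
      Nat.cast_sub (by omega)]
    push_cast
    rw [show 1 / (2 * ((d : ℝ) - 2)) * (((d : ℝ) - 2) * 2) = 1 by field_simp, Real.rpow_one]
  obtain ⟨z, hz, hz0, hzc⟩ := exists_ne_zero_mem_of_forall_gt Λ hη (c := c) fun r hr => by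
    obtain ⟨i, j, hij, hne⟩ := exists_bivectorCoord_ne_zero hZ0
    rw [bivectorCoord_ιMulti] at hne
    refine exists_ne_zero_mem_abs_le_mul hd Λ hΛ hη hz₁ hz₂ ⟨i, j, hne⟩ (hc0.trans hr)
      (fun i j hij => ?_) ?_
    · rw [← bivectorCoord_ιMulti z₁ z₂ hij]
      exact hZ i j hij
    · rw [← hD, ← hcd]
      have : d - 2 ≠ 0 := by omega
      gcongr
  refine ⟨z, ⟨⟨c⁻¹ • z, fun i => ?_, smul_inv_smul₀ hc0.ne' z⟩, hz⟩, hz0⟩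
  rw [PiLp.smul_apply, smul_eq_mul, abs_mul, abs_inv, abs_of_pos hc0, inv_mul_le_iff₀ hc0]
  exact hzc i
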